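/- Consider an asynchronous system of $n$ deterministic processes with ids $0,\dots,n-1$ that communicate through $m$ shared memory locations, each storing a single bit, initially $0$. In each step, the process selected by an adversarial scheduler atomically performs one instruction on one location and then does local computation based on the response. The instructions are: $\mathrm{read}()$, which returns the bit; $\mathrm{write}(x)$, which stores $x$ and returns nothing; $\mathrm{test\text{-}and\text{-}set}()$, which returns the bit and sets it to $1$; and $\mathrm{reset}()$, which sets the bit to $0$ and returns nothing. In $n$-consensus (obstruction-free $n$-valued consensus among $n$ processes), each process has an arbitrary input in $\{0,\dots,n-1\}$ and decides a value, after which it takes no more steps. It is required that, for all inputs and all schedules, all decisions are the same (agreement), every decision is the input of some process (validity), and from every reachable configuration, every process decides after finitely many steps of its solo execution (obstruction-freedom). **Theorem.** Let $\mathcal I=\{\mathrm{read}(),a,b\}$, where $a$ is either $\mathrm{write}(1)$ or $\mathrm{test\text{-}and\text{-}set}()$ and $b$ is either $\mathrm{write}(0)$ or $\mathrm{reset}()$. There is a constant $c$ such that, for every $n\ge 2$, it is possible to solve $n$-consensus using at most $c\, n\log n$ memory locations that support only the instructions in $\mathcal I$. -/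

import Mathlib

namespace SharedMemory

/-- A deterministic instruction on a memory location with contents in `V`: the old contents determine
the new contents and the response (`none` if the instruction returns nothing). -/
abbrev Instruction (V : Type) : Type := V → V × Option V

/-- `read()` returns the contents and does not change them. -/
def read {V : Type} : Instruction V := fun v => (v, some v)

/-- `write(x)` stores `x` and returns nothing. -/
def write {V : Type} (x : V) : Instruction V := fun _ => (x, none)

/-- `test-and-set()` on a binary location returns the contents and sets the location to 1. -/
def testAndSet : Instruction Bool := fun v => (true, some v)

/-- `reset()` on a binary location sets it to 0 and returns nothing. -/
def reset : Instruction Bool := fun _ => (false, none)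

/-- What a process does in a given local state: it has either decided a value in `{0, …, k-1}`, or it
is poised to perform one instruction from `I` on one of the `m` memory locations. -/
inductive Action {V : Type} (I : Set (Instruction V)) (m k : ℕ) : Type where
  | decided (v : Fin k) : Action I m k
  | poised (loc : Fin m) (op : I) : Action I m k

/-- A deterministic algorithm for `n` processes with inputs in `{0, …, k-1}`, using `m` memory
locations that support exactly the instructions in `I`. The initial local state depends on the id and
the input of the process; `next` is the local computation after a response has been received. -/
structure Algorithm {V : Type} (I : Set (Instruction V)) (n m k : ℕ) where
  State : Type
  init : Fin n → Fin k → State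
  action : State → Action I m k
  next : State → Option V → State

variable {V : Type} {I : Set (Instruction V)} {n m k : ℕ}

/-- A configuration: the state of every process and the contents of every memory location. -/
structure Config (A : Algorithm I n m k) where
  state : Fin n → A.State
  mem : Fin m → V

namespace Algorithm

/-- The initial configuration for the given inputs, in which every location contains `v₀`. -/
def initConfig (A : Algorithm I n m k) (v₀ : V) (input : Fin n → Fin k) : Config A where
  state p := A.init p (input p)
  mem _ := v₀

/-- One step of process `p`: an atomic execution of the instruction that `p` is poised to perform,
followed by local computation of `p`. A process that has decided takes no step. -/
def Step (A : Algorithm I n m k) (p : Fin n) (C C' : Config A) : Prop :=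
  ∃ (loc : Fin m) (op : I), A.action (C.state p) = Action.poised loc op ∧
    C' = { state := Function.update C.state p (A.next (C.state p) (op.1 (C.mem loc)).2)
           mem := Function.update C.mem loc (op.1 (C.mem loc)).1 }

/-- `C'` is reached from `C` by a finite execution under some schedule. -/
def Reaches (A : Algorithm I n m k) : Config A → Config A → Prop :=
  Relation.ReflTransGen fun C C' => ∃ p, A.Step p C C'

/-- `C'` is reached from `C` by a finite solo execution of process `p`. -/
def ReachesSolo (A : Algorithm I n m k) (p : Fin n) : Config A → Config A → Prop :=
  Relation.ReflTransGen (A.Step p)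

/-- Process `p` has decided `v` in configuration `C`. -/
def Decides (A : Algorithm I n m k) (C : Config A) (p : Fin n) (v : Fin k) : Prop :=
  A.action (C.state p) = Action.decided v

/-- The algorithm solves obstruction-free `k`-valued consensus among `n` processes from memory
locations that all initially contain `v₀`: for all inputs, every reachable configuration satisfies
agreement, validity, and obstruction-freedom. -/
def SolvesConsensus (A : Algorithm I n m k) (v₀ : V) : Prop :=
  ∀ (input : Fin n → Fin k) (C : Config A), A.Reaches (A.initConfig v₀ input) C →
    (∀ p q v w, A.Decides C p v → A.Decides C q w → v = w) ∧
    (∀ p v, A.Decides C p v → ∃ q, input q = v) ∧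
    (∀ p, ∃ C' v, A.ReachesSolo p C C' ∧ A.Decides C' p v)

end Algorithm

/-- `n`-consensus (obstruction-free `n`-valued consensus among `n` processes) can be solved with `m`
memory locations, all initially `v₀`, that support only the instructions in `I`. -/
def NConsensusSolvable {V : Type} (I : Set (Instruction V)) (v₀ : V) (n m : ℕ) : Prop :=
  ∃ A : Algorithm I n m n, A.SolvesConsensus v₀

end SharedMemory

/-! Values are stored in `M` cells of `⌈log₂ n⌉` bits, with `M = 7n` at the end. A process clears
its dirty bit, scans the cells, adopts the majority value if that value has been announced, and then
checks its dirty bit. If the bit is set, it rescans. If the bit is clear, it decides when its whole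
view holds its preference; otherwise it writes its preference into one bad cell and then sets every
dirty bit.

Agreement: a bit that changed after a clean scan read it was overwritten by a process that still has
to set the scanner's dirty bit. Such a process writes to only one cell, so a clean view is wrong in
at most `n` cells (`Inv.card_bad_le`). When `v` is decided, at most `n` cells fail to hold it and at
most `n` more are targets of pending writes of other values. These `2n` exposed cells never grow in
number: a later clean view misses `v` in at most `3n < M / 2` cells, so `v` has the majority in it
and is adopted (`Inv.isMajority`, `Inv.exposed_anti`). Two values cannot each miss at most `2n` of
more than `6n` cells.

Validity: initial zeros and interleaved bit writes can form the code of a value that is nobody's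
input; the presence bits keep such values from being adopted.

Termination: in a solo run the scans are exact, and each round reduces the number of cells that do
not hold the preference (`solo_loop`). -/

namespace CellConsensus

open SharedMemory Function

open scoped Classical

/-- The locations: `M` cells of `L` bits each, a dirty bit for each process, and a bit for each value
that tells whether this value is known to be an input. -/
inductive Loc (n M L : ℕ) : Type where
  | cell (b : Fin M × Fin L)
  | dirty (q : Fin n)
  | present (u : Fin n)

/-- The local states of a process. In `writing j u todo` the process prefers `u` and has the locations
in `todo` still to write, where `j` is the only cell it may write to. In `scan u todo view` the bits
in `todo` are still to be read. In `check u view` the scan is complete, and the process is about to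
check its dirty bit. -/
inductive Phase (n M L : ℕ) : Type where
  | writing (j : Fin M) (u : Fin n) (todo : List (Loc n M L))
  | scan (u : Fin n) (todo : List (Fin M × Fin L)) (view : Fin M × Fin L → Bool)
  | check (u : Fin n) (view : Fin M × Fin L → Bool)
  | done (u : Fin n)

/-- A configuration of the protocol. -/
structure Conf (n M L : ℕ) : Type where
  phase : Fin n → Phase n M L
  mem : Loc n M L → Bool

section Protocol

variable {n M L : ℕ} (enc : Fin n → Fin L → Bool)

/-- The contents of the bits of the cells. -/
def Conf.bits (a : Conf n M L) : Fin M × Fin L → Bool := fun b => a.mem (.cell b)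

/-- The cells that do not hold the value `v`. -/
noncomputable def bad (x : Fin M × Fin L → Bool) (v : Fin n) : Finset (Fin M) :=
  Finset.univ.filter fun j => ∃ i, x (j, i) ≠ enc v i

/-- More than half of the cells hold `v`. -/
def IsMajority (x : Fin M × Fin L → Bool) (v : Fin n) : Prop := 2 * (bad enc x v).card < M

/-- The value held by more than half of the cells, or `u` if there is none. -/
noncomputable def majority (x : Fin M × Fin L → Bool) (u : Fin n) : Fin n :=
  if h : ∃ v, IsMajority enc x v then h.choose else u

/-- A cell that does not hold `u`, if there is one. -/
noncomputable def target [NeZero M] (x : Fin M × Fin L → Bool) (u : Fin n) : Fin M :=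
  if h : (bad enc x u).Nonempty then h.choose else 0

/-- What a process that prefers `u` writes into a location. -/
def value (u : Fin n) : Loc n M L → Bool
  | .cell b => enc u b.2
  | .dirty _ => true
  | .present _ => true

/-- The locations a process writes in order to store its preference in cell `j`. -/
def writeList (j : Fin M) : List (Loc n M L) :=
  (List.finRange L).map (fun i => .cell (j, i)) ++ (List.finRange n).map .dirty

/-- All bits of all cells. -/
noncomputable def allBits (M L : ℕ) : List (Fin M × Fin L) := Finset.univ.toList

/-- The preference of a process. -/
def Phase.pref : Phase n M L → Fin n
  | .writing _ u _ => u
  | .scan u _ _ => u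
  | .check u _ => u
  | .done u => u

/-- The state of a process after a scan that was found to be clean. -/
noncomputable def afterScan [NeZero M] (u : Fin n) (view : Fin M × Fin L → Bool) : Phase n M L :=
  if (bad enc view u).Nonempty then .writing (target enc view u) u (writeList (target enc view u))
  else .done u

/-- The steps of process `p`. -/
inductive Move [NeZero M] (p : Fin n) (a : Conf n M L) : Conf n M L → Prop where
  | write (j u l t) (h : a.phase p = .writing j u (l :: t)) :
      Move p a ⟨update a.phase p (.writing j u t), update a.mem l (value enc u l)⟩
  | clear (j u) (h : a.phase p = .writing j u []) :
      Move p a ⟨update a.phase p (.scan u (allBits M L) fun _ => false),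
        update a.mem (.dirty p) false⟩
  | readBit (u b t view) (h : a.phase p = .scan u (b :: t) view) :
      Move p a ⟨update a.phase p (.scan u t (update view b (a.mem (.cell b)))), a.mem⟩
  | adopt (u view) (h : a.phase p = .scan u [] view) :
      Move p a ⟨update a.phase p (.check
        (if a.mem (.present (majority enc view u)) then majority enc view u else u) view), a.mem⟩
  | restart (u view) (h : a.phase p = .check u view) (hd : a.mem (.dirty p) = true) :
      Move p a ⟨update a.phase p (.writing 0 u []), a.mem⟩
  | finish (u view) (h : a.phase p = .check u view) (hd : a.mem (.dirty p) = false) :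
      Move p a ⟨update a.phase p (afterScan enc u view), a.mem⟩

/-- The initial configuration. -/
def start [NeZero M] (input : Fin n → Fin n) : Conf n M L where
  -- The input is announced before the first scan, so every preference is present from then on.
  phase p := .writing 0 (input p) [.present (input p)]
  mem _ := false

/-- Executions of the protocol. -/
def Run [NeZero M] : Conf n M L → Conf n M L → Prop :=
  Relation.ReflTransGen fun a a' => ∃ p, Move enc p a a'

/-! ### Majorities -/

variable {enc}

lemma mem_bad {x : Fin M × Fin L → Bool} {v : Fin n} {j : Fin M} :
    j ∈ bad enc x v ↔ ∃ i, x (j, i) ≠ enc v i := by simp [bad]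

/-- A cell has only one content, so by injectivity of the encoding it is bad for at least one of two
distinct values. -/
lemma le_card_bad_add (henc : Injective enc) (x : Fin M × Fin L → Bool) {v w : Fin n} (h : v ≠ w) :
    M ≤ (bad enc x v).card + (bad enc x w).card := by
  have hu : bad enc x v ∪ bad enc x w = Finset.univ := by
    ext j
    simp only [Finset.mem_union, mem_bad, Finset.mem_univ, iff_true]
    by_contra! hj
    exact h (henc (funext fun i => (hj.1 i).symm.trans (hj.2 i)))
  calc M = (bad enc x v ∪ bad enc x w).card := by rw [hu]; simp
    _ ≤ _ := Finset.card_union_le _ _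

lemma IsMajority.unique (henc : Injective enc) {x : Fin M × Fin L → Bool} {v w : Fin n}
    (hv : IsMajority enc x v) (hw : IsMajority enc x w) : v = w := by
  by_contra h
  have := le_card_bad_add henc x h
  unfold IsMajority at hv hw
  omega

lemma IsMajority.majority_eq (henc : Injective enc) {x : Fin M × Fin L → Bool} {v : Fin n}
    (hv : IsMajority enc x v) (u : Fin n) : majority enc x u = v := by
  have h : ∃ v, IsMajority enc x v := ⟨v, hv⟩
  rw [majority, dif_pos h]
  exact h.choose_spec.unique henc hv

lemma majority_eq_or (x : Fin M × Fin L → Bool) (u : Fin n) :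
    IsMajority enc x (majority enc x u) ∨ majority enc x u = u := by
  unfold majority
  split_ifs with h
  · exact .inl h.choose_spec
  · exact .inr rfl

lemma target_mem_bad [NeZero M] {x : Fin M × Fin L → Bool} {u : Fin n}
    (h : (bad enc x u).Nonempty) : target enc x u ∈ bad enc x u := by
  rw [target, dif_pos h]
  exact h.choose_spec

/-! ### Invariants -/

/-- A process writes bits only in cell `j`, and it sets all dirty bits afterwards; it announces only
its preference `u`. -/
def WellOrdered (j : Fin M) (u : Fin n) : List (Loc n M L) → Prop
  | [] => True
  | l :: t => (∀ b, l = .cell b → b.1 = j ∧ ∀ q, Loc.dirty q ∈ t) ∧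
      (∀ w, l = .present w → w = u) ∧ WellOrdered j u t

lemma wellOrdered_writeList (j : Fin M) (u : Fin n) :
    WellOrdered j u (writeList j : List (Loc n M L)) := by
  have h₁ : ∀ s : List (Fin n), WellOrdered (L := L) j u (s.map .dirty) := by
    intro s
    induction s with
    | nil => trivial
    | cons q s ih => exact ⟨by simp, by simp, ih⟩
  unfold writeList
  induction List.finRange L with
  | nil => exact h₁ _
  | cons i s ih => exact ⟨by rintro _ ⟨⟩; simp, by simp, ih⟩

/-- The bits that a process that is scanning has read, together with their contents then. -/
def Phase.HasRead : Phase n M L → Fin M × Fin L → Bool → Prop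
  | .scan _ todo view, b, x => b ∉ todo ∧ view b = x
  | .check _ view, b, x => view b = x
  | _, _, _ => False

variable [NeZero M]

variable (enc) in
/-- The cell that a process is writing to, or is about to write to. -/
noncomputable def Phase.target : Phase n M L → Fin M
  | .writing j _ _ => j
  | .check u view => CellConsensus.target enc view u
  | _ => 0

variable (enc) in
/-- The process may write a value other than `v` although `v` has the majority. -/
def Phase.Threatens (v : Fin n) : Phase n M L → Prop
  | .writing _ u todo => u ≠ v ∧ todo ≠ []
  -- This covers a process that saw a majority for `v` but did not adopt it because `v` was not yet
  -- announced. Without a majority for `v` in the view, the dirty check must fail once `v` has been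
  -- decided.
  | .check u view => u ≠ v ∧ IsMajority enc view v
  | _ => False

variable (enc) in
/-- The cells that do not hold `v` or that may be overwritten although `v` has the majority. -/
def exposed (v : Fin n) (a : Conf n M L) : Set (Fin M) :=
  {j | j ∈ bad enc a.bits v ∨ ∃ q, (a.phase q).Threatens enc v ∧ (a.phase q).target enc = j}

variable (enc) in
/-- The invariant of the protocol. -/
structure Inv (input : Fin n → Fin n) (a : Conf n M L) : Prop where
  pref_input : ∀ p, ∃ q, input q = (a.phase p).pref
  present_input : ∀ u, a.mem (.present u) = true → ∃ q, input q = u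
  pref_present : ∀ p, a.mem (.present (a.phase p).pref) = true ∨
    ∃ j u todo, a.phase p = .writing j u todo ∧ Loc.present u ∈ todo
  wellOrdered : ∀ p j u todo, a.phase p = .writing j u todo → WellOrdered j u todo
  -- Any outdated bit of a clean scan is charged to a process that is still committed to that one
  -- cell.
  stale : ∀ p, a.mem (.dirty p) = false → ∀ b x, (a.phase p).HasRead b x → a.mem (.cell b) ≠ x →
    ∃ q u todo, a.phase q = .writing b.1 u todo ∧ Loc.dirty p ∈ todo
  exposed_le : ∀ p v, a.phase p = .done v → (exposed enc v a).ncard ≤ 2 * n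

lemma inv_start (input : Fin n → Fin n) : Inv enc input (start input : Conf n M L) where
  pref_input p := ⟨p, rfl⟩
  present_input := by simp [start]
  pref_present p := .inr ⟨_, _, _, rfl, by simp⟩
  wellOrdered := by
    intro p j u todo h
    simp only [start, Phase.writing.injEq] at h
    obtain ⟨rfl, rfl, rfl⟩ := h
    exact ⟨by simp, by simp, trivial⟩
  stale := by simp [start, Phase.HasRead]
  exposed_le := by simp [start]

/-! ### Accuracy of clean scans, agreement, and control of the exposed cells -/

/-- Each process has a single target; this is the source of every `n` in the bounds. -/
lemma ncard_target_le (a : Conf n M L) (s : Set (Fin M))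
    (h : ∀ j ∈ s, ∃ q, (a.phase q).target enc = j) : s.ncard ≤ n := by
  calc s.ncard ≤ (Set.range fun q => (a.phase q).target enc).ncard :=
        Set.ncard_le_ncard (fun j hj => h j hj) (Set.toFinite _)
    _ ≤ n := by
        rw [← Set.image_univ]
        exact (Set.ncard_image_le (Set.toFinite _)).trans (by simp [Set.ncard_univ])

/-- A clean scan is out of date in at most `n` cells. -/
lemma Inv.card_bad_le {input : Fin n → Fin n} {a : Conf n M L} (ha : Inv enc input a) {p u : Fin n}
    {view : Fin M × Fin L → Bool} (h : a.phase p = .check u view) (hd : a.mem (.dirty p) = false)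
    (v : Fin n) : (bad enc a.bits v).card ≤ (bad enc view v).card + n ∧
      (bad enc view v).card ≤ (bad enc a.bits v).card + n := by
  have hs : {j : Fin M | ∃ i, a.bits (j, i) ≠ view (j, i)}.ncard ≤ n := by
    refine ncard_target_le (enc := enc) a _ ?_
    rintro j ⟨i, hi⟩
    obtain ⟨q, w, todo, hq, -⟩ := ha.stale p hd (j, i) (view (j, i)) (by rw [h]; rfl) hi
    exact ⟨q, by rw [hq]; rfl⟩
  have key : ∀ x y : Fin M × Fin L → Bool, {j : Fin M | ∃ i, x (j, i) ≠ y (j, i)}.ncard ≤ n →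
      (bad enc x v).card ≤ (bad enc y v).card + n := by
    intro x y hxy
    rw [← Set.ncard_coe_finset, ← Set.ncard_coe_finset]
    refine (Set.ncard_le_ncard ?_ (Set.toFinite _)).trans
      ((Set.ncard_union_le _ _).trans (Nat.add_le_add_left hxy _))
    intro j hj
    obtain ⟨i, hi⟩ := mem_bad.1 (Finset.mem_coe.1 hj)
    by_cases hxi : x (j, i) = y (j, i)
    · exact .inl (Finset.mem_coe.2 (mem_bad.2 ⟨i, hxi ▸ hi⟩))
    · exact .inr ⟨i, hxi⟩
  exact ⟨key _ _ hs, key _ _ (by simpa only [ne_comm] using hs)⟩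

/-- Once `v` has been decided, every clean scan finds a majority for `v`. -/
lemma Inv.isMajority (hM : 6 * n < M) {input : Fin n → Fin n} {a : Conf n M L}
    (ha : Inv enc input a) {p p' u v : Fin n} {view : Fin M × Fin L → Bool}
    (hv : a.phase p' = .done v) (h : a.phase p = .check u view)
    (hd : a.mem (.dirty p) = false) : IsMajority enc view v := by
  have h₁ := (ha.card_bad_le h hd v).2
  have h₂ : (bad enc a.bits v).card ≤ 2 * n := by
    rw [← Set.ncard_coe_finset]
    exact (Set.ncard_le_ncard (fun j hj => .inl hj) (Set.toFinite _)).trans (ha.exposed_le p' v hv)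
  unfold IsMajority
  omega

lemma Inv.agreement (henc : Injective enc) (hM : 6 * n < M) {input : Fin n → Fin n}
    {a : Conf n M L} (ha : Inv enc input a) {p q v w : Fin n} (hv : a.phase p = .done v)
    (hw : a.phase q = .done w) : v = w := by
  by_contra hne
  have h₁ := le_card_bad_add henc a.bits hne
  have h₂ : ∀ p v, a.phase p = .done v → (bad enc a.bits v).card ≤ 2 * n := fun p v hv => by
    rw [← Set.ncard_coe_finset]
    exact (Set.ncard_le_ncard (fun j hj => .inl hj) (Set.toFinite _)).trans (ha.exposed_le p v hv)
  have := h₂ p v hv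
  have := h₂ q w hw
  omega

/-- Exposure is monotone in the threats and in the bad cells. -/
lemma exposed_subset {v : Fin n} {a a' : Conf n M L} (p : Fin n)
    (hq : ∀ q, q ≠ p → a'.phase q = a.phase q)
    (hb : ∀ j, j ∈ bad enc a'.bits v → j ∈ exposed enc v a)
    (hp : (a'.phase p).Threatens enc v →
      (a.phase p).Threatens enc v ∧ (a.phase p).target enc = (a'.phase p).target enc) :
    exposed enc v a' ⊆ exposed enc v a := by
  rintro j (hj | ⟨q, ht, rfl⟩)
  · exact hb j hj
  · by_cases hqp : q = p
    · subst hqp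
      exact .inr ⟨q, hp ht⟩
    · rw [hq q hqp] at ht ⊢
      exact .inr ⟨q, ht, rfl⟩

lemma Move.phase_of_ne {p q : Fin n} {a a' : Conf n M L} (h : Move enc p a a') (hq : q ≠ p) :
    a'.phase q = a.phase q := by
  cases h <;> simp [hq]

/-- Once `v` has been decided, no further cells become exposed. -/
lemma Inv.exposed_anti (henc : Injective enc) (hM : 6 * n < M) {input : Fin n → Fin n}
    {a a' : Conf n M L} (ha : Inv enc input a) {p p' v : Fin n} (hv : a.phase p' = .done v)
    (h : Move enc p a a') : exposed enc v a' ⊆ exposed enc v a := by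
  have hpres : a.mem (.present v) = true := by
    rcases ha.pref_present p' with h | ⟨j, u, todo, h, -⟩
    · simpa [hv, Phase.pref] using h
    · simp [hv] at h
  refine exposed_subset p (fun q hq => h.phase_of_ne hq) ?_ ?_
  · cases h with
    | write j u l t h =>
      intro k hk
      obtain ⟨i, hi⟩ := mem_bad.1 hk
      -- If this very write makes the bit wrong for `v`, the writer prefers another value, so its
      -- cell was already exposed through the pending write.
      by_cases hl : l = .cell (k, i)
      · subst hl
        have hkj := ((ha.wellOrdered p j u _ h).1 _ rfl).1
        refine .inr ⟨p, ?_, by rw [h]; exact hkj.symm⟩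
        rw [h]
        refine ⟨?_, by simp⟩
        rintro rfl
        simp [Conf.bits, value] at hi
      · refine .inl (mem_bad.2 ⟨i, ?_⟩)
        simpa [Conf.bits, Ne.symm hl] using hi
    | clear j u h => exact fun k hk => .inl (by simpa [mem_bad, Conf.bits] using hk)
    | readBit u b t view h => exact fun k hk => .inl hk
    | adopt u view h => exact fun k hk => .inl hk
    | restart u view h hd => exact fun k hk => .inl hk
    | finish u view h hd => exact fun k hk => .inl hk
  · cases h with
    | write j u l t h =>
      simp only [update_self, h]
      exact fun ht => ⟨⟨ht.1, by simp⟩, rfl⟩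
    | clear j u h => simp [Phase.Threatens]
    | readBit u b t view h => simp [Phase.Threatens]
    | adopt u view h =>
      simp only [update_self]
      rintro ⟨hne, hmaj⟩
      -- Since `v` is announced, a process that sees a majority for `v` now prefers `v`.
      rw [hmaj.majority_eq henc, if_pos hpres] at hne
      exact absurd rfl hne
    | restart u view h hd => simp [Phase.Threatens]
    | finish u view h hd =>
      -- The view is clean at the moment the target becomes a pending write, so it shows a majority
      -- for `v`. A process preferring another value was therefore already a threat with this
      -- target.
      have hmaj := ha.isMajority hM hv h hd
      simp only [update_self, h, afterScan]
      split_ifs with hne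
      · exact fun ht => ⟨⟨ht.1, hmaj⟩, rfl⟩
      · exact fun ht => ht.elim

/-- A value that is being decided has few exposed cells. -/
lemma Inv.exposed_le_of_finish {input : Fin n → Fin n} {a a' : Conf n M L}
    (ha : Inv enc input a) {p u : Fin n} {view : Fin M × Fin L → Bool}
    (h : a.phase p = .check u view) (hd : a.mem (.dirty p) = false)
    (hb : ¬ (bad enc view u).Nonempty) (hmem : a'.mem = a.mem) :
    (exposed enc u a').ncard ≤ 2 * n := by
  -- The view has no bad cell, so at most `n` cells are bad now; pending threats add at most `n`
  -- more.
  have h₁ := (ha.card_bad_le h hd u).1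
  rw [Finset.not_nonempty_iff_eq_empty.1 hb, ← Set.ncard_coe_finset] at h₁
  have h₂ : {j | ∃ q, (a'.phase q).Threatens enc u ∧ (a'.phase q).target enc = j}.ncard ≤ n :=
    ncard_target_le (enc := enc) a' _ fun j ⟨q, _, hq⟩ => ⟨q, hq⟩
  have h₃ : exposed enc u a' = (bad enc a.bits u : Set (Fin M)) ∪
      {j | ∃ q, (a'.phase q).Threatens enc u ∧ (a'.phase q).target enc = j} := by
    have : a'.bits = a.bits := by unfold Conf.bits; rw [hmem]
    ext j
    simp [exposed, this]
  rw [h₃]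
  refine (Set.ncard_union_le _ _).trans ?_
  simp only [Finset.card_empty] at h₁
  omega

/-! ### Preservation of the invariant -/

lemma Move.present_mono {p u : Fin n} {a a' : Conf n M L} (h : Move enc p a a')
    (hu : a.mem (.present u) = true) : a'.mem (.present u) = true := by
  cases h with
  | write j w l t h =>
    by_cases hl : l = .present u
    · subst hl; simp [value]
    · simpa [Ne.symm hl] using hu
  | clear j w h => simpa using hu
  | _ => exact hu

@[simp] lemma pref_afterScan (u : Fin n) (view : Fin M × Fin L → Bool) :
    (afterScan enc u view).pref = u := by
  unfold afterScan
  split_ifs <;> rfl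

lemma Inv.pref_input_move {p : Fin n} {input : Fin n → Fin n} {a a' : Conf n M L}
    (ha : Inv enc input a) (h : Move enc p a a') (q : Fin n) :
    ∃ r, input r = (a'.phase q).pref := by
  by_cases hq : q = p
  · subst hq
    have hp := ha.pref_input q
    cases h with
    | adopt u view h =>
      rw [h] at hp
      simp only [update_self, Phase.pref]
      split_ifs with hm
      · exact ha.present_input _ hm
      · exact hp
    | finish u view h hd =>
      rw [h] at hp
      simp only [update_self, pref_afterScan]
      exact hp
    | _ =>
      rename_i h
      simp_all [Phase.pref]
  · rw [h.phase_of_ne hq]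
    exact ha.pref_input q

lemma Inv.present_input_move {p : Fin n} {input : Fin n → Fin n} {a a' : Conf n M L}
    (ha : Inv enc input a) (h : Move enc p a a') (u : Fin n)
    (hu : a'.mem (.present u) = true) : ∃ q, input q = u := by
  cases h with
  | write j w l t h =>
    by_cases hl : l = .present u
    · have := ha.pref_input p
      rw [h] at this
      rw [((ha.wellOrdered p j w _ h).2.1 _ hl)]
      exact this
    · exact ha.present_input u (by simpa [Ne.symm hl] using hu)
  | clear j w h => exact ha.present_input u (by simpa using hu)
  | _ => exact ha.present_input u hu

lemma Inv.pref_present_move {p : Fin n} {input : Fin n → Fin n} {a a' : Conf n M L}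
    (ha : Inv enc input a) (h : Move enc p a a') (q : Fin n) :
    a'.mem (.present (a'.phase q).pref) = true ∨
      ∃ j u todo, a'.phase q = .writing j u todo ∧ Loc.present u ∈ todo := by
  by_cases hq : q = p
  · subst hq
    have hp := ha.pref_present q
    have mono := fun u => h.present_mono (u := u)
    cases h with
    | write j u l t h =>
      simp only [update_self, Phase.pref, h, Phase.writing.injEq] at hp mono ⊢
      rcases hp with hp | ⟨_, _, _, ⟨rfl, rfl, rfl⟩, hp⟩
      · exact .inl (mono _ hp)
      · rcases List.mem_cons.1 hp with rfl | hp
        · left; simp [value]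
        · exact .inr ⟨_, _, _, ⟨rfl, rfl, rfl⟩, hp⟩
    | adopt u view h =>
      left
      simp only [update_self, Phase.pref]
      split_ifs with hm
      · exact hm
      · simpa [h, Phase.pref] using hp
    | finish u view h hd =>
      left
      simp only [update_self, pref_afterScan]
      simpa [h, Phase.pref] using hp
    | clear j u h =>
      left
      simp only [h, Phase.writing.injEq] at hp
      rcases hp with hp | ⟨_, _, _, ⟨rfl, rfl, rfl⟩, hp⟩
      · simpa [Phase.pref] using hp
      · simp at hp
    | readBit u b t view h =>
      left
      simpa [h, Phase.pref] using hp
    | restart u view h hd =>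
      left
      simpa [h, Phase.pref] using hp
  · rw [h.phase_of_ne hq]
    exact (ha.pref_present q).imp h.present_mono id

lemma Inv.wellOrdered_move {p : Fin n} {input : Fin n → Fin n} {a a' : Conf n M L}
    (ha : Inv enc input a) (h : Move enc p a a') (q : Fin n) (j : Fin M) (u : Fin n)
    (todo : List (Loc n M L)) (hw : a'.phase q = .writing j u todo) : WellOrdered j u todo := by
  by_cases hq : q = p
  · subst hq
    cases h with
    | write j' u' l t h =>
      simp only [update_self, Phase.writing.injEq] at hw
      obtain ⟨rfl, rfl, rfl⟩ := hw
      exact (ha.wellOrdered q _ _ _ h).2.2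
    | restart u' view h hd =>
      simp only [update_self, Phase.writing.injEq] at hw
      obtain ⟨rfl, rfl, rfl⟩ := hw
      trivial
    | finish u' view h hd =>
      simp only [update_self, afterScan] at hw
      split_ifs at hw
      cases hw
      exact wellOrdered_writeList _ _
    | _ => simp at hw
  · rw [h.phase_of_ne hq] at hw
    exact ha.wellOrdered q j u todo hw

/-- An old witness survives unless it sets the dirty bit of `q`, which `hd` excludes. A newly
outdated bit has its writer as witness, because `WellOrdered` puts all dirty bits after it. -/
lemma Inv.stale_move {p : Fin n} {input : Fin n → Fin n} {a a' : Conf n M L}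
    (ha : Inv enc input a) (h : Move enc p a a') (q : Fin n) (hd : a'.mem (.dirty q) = false)
    (b : Fin M × Fin L) (x : Bool) (hr : (a'.phase q).HasRead b x) (hx : a'.mem (.cell b) ≠ x) :
    ∃ r u todo, a'.phase r = .writing b.1 u todo ∧ Loc.dirty q ∈ todo := by
  have lift : (∃ r u todo, a.phase r = .writing b.1 u todo ∧ Loc.dirty q ∈ todo) →
      (∀ j u l t, a.phase p = .writing j u (l :: t) → l ≠ .dirty q ∧
        a'.phase p = .writing j u t) →
      ∃ r u todo, a'.phase r = .writing b.1 u todo ∧ Loc.dirty q ∈ todo := by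
    rintro ⟨r, u, todo, hw, hmem⟩ hp
    by_cases hrp : r = p
    · subst hrp
      cases todo with
      | nil => simp at hmem
      | cons l t =>
        obtain ⟨hl, ht⟩ := hp _ _ _ _ hw
        exact ⟨r, u, t, ht, (List.mem_cons.1 hmem).resolve_left (Ne.symm hl)⟩
    · exact ⟨r, u, todo, by rw [h.phase_of_ne hrp, hw], hmem⟩
  cases h with
  | write j u l t h =>
    have hqp : q ≠ p := by
      rintro rfl
      simp [Phase.HasRead] at hr
    have hl : l ≠ .dirty q := by
      rintro rfl
      simp [value] at hd
    by_cases hlb : l = .cell b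
    · obtain ⟨hj, ht⟩ := (ha.wellOrdered p j u _ h).1 b hlb
      exact ⟨p, u, t, by simp [hj], ht q⟩
    · refine lift (ha.stale q ?_ b x ?_ ?_) ?_
      · simpa [Ne.symm hl] using hd
      · simpa [hqp] using hr
      · simpa [Ne.symm hlb] using hx
      · intro j' u' l' t' h'
        rw [h] at h'
        cases h'
        exact ⟨hl, by simp⟩
  | clear j u h =>
    -- The process that clears its dirty bit starts a new scan and has read nothing yet.
    have hqp : q ≠ p := by
      rintro rfl
      simp [Phase.HasRead, allBits] at hr
    refine lift (ha.stale q ?_ b x ?_ ?_) (by simp [h])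
    · simpa [hqp] using hd
    · simpa [hqp] using hr
    · simpa using hx
  | readBit u b' t view h =>
    refine lift (ha.stale q hd b x ?_ hx) (by simp [h])
    by_cases hqp : q = p
    · subst hqp
      rw [h]
      simp only [update_self, Phase.HasRead] at hr
      -- The bit just read is up to date.
      have hb : b ≠ b' := by
        rintro rfl
        exact hx (by simpa using hr.2)
      exact ⟨by simpa [hb] using hr.1, by simpa [hb] using hr.2⟩
    · simpa [hqp] using hr
  | adopt u view h =>
    refine lift (ha.stale q hd b x ?_ hx) (by simp [h])
    by_cases hqp : q = p
    · subst hqp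
      rw [h]
      simpa [Phase.HasRead] using hr
    · simpa [hqp] using hr
  | restart u view h hd' =>
    refine lift (ha.stale q hd b x ?_ hx) (by simp [h])
    by_cases hqp : q = p
    · subst hqp
      simp [Phase.HasRead] at hr
    · simpa [hqp] using hr
  | finish u view h hd' =>
    refine lift (ha.stale q hd b x ?_ hx) (by simp [h])
    by_cases hqp : q = p
    · subst hqp
      simp only [update_self, afterScan] at hr
      split_ifs at hr <;> simp [Phase.HasRead] at hr
    · simpa [hqp] using hr

lemma Inv.exposed_le_move (henc : Injective enc) (hM : 6 * n < M) {p : Fin n}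
    {input : Fin n → Fin n} {a a' : Conf n M L} (ha : Inv enc input a) (h : Move enc p a a')
    (q v : Fin n) (hv : a'.phase q = .done v) : (exposed enc v a').ncard ≤ 2 * n := by
  by_cases hq : a.phase q = .done v
  · exact (Set.ncard_le_ncard (ha.exposed_anti henc hM hq h) (Set.toFinite _)).trans
      (ha.exposed_le q v hq)
  have hqp : q = p := by
    by_contra hqp
    exact hq (by rw [← h.phase_of_ne hqp, hv])
  subst hqp
  cases h with
  | finish u view h hd =>
    simp only [update_self, afterScan] at hv
    split_ifs at hv with hb
    cases hv
    exact ha.exposed_le_of_finish h hd hb rfl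
  | _ => simp at hv

lemma Inv.move (henc : Injective enc) (hM : 6 * n < M) {p : Fin n} {input : Fin n → Fin n}
    {a a' : Conf n M L} (ha : Inv enc input a) (h : Move enc p a a') : Inv enc input a' where
  pref_input := ha.pref_input_move h
  present_input := ha.present_input_move h
  pref_present := ha.pref_present_move h
  wellOrdered := ha.wellOrdered_move h
  stale := ha.stale_move h
  exposed_le := ha.exposed_le_move henc hM h

lemma Run.inv (henc : Injective enc) (hM : 6 * n < M) {input : Fin n → Fin n} {a : Conf n M L}
    (h : Run enc (start input) a) : Inv enc input a := by
  induction h with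
  | refl => exact inv_start input
  | tail _ h ih => exact ih.move henc hM h.choose_spec

/-! ### Solo executions -/

variable (enc) in
/-- Solo executions of process `p`. -/
def Solo (p : Fin n) : Conf n M L → Conf n M L → Prop := Relation.ReflTransGen (Move enc p)

/-- A process that runs alone completes its writes. -/
lemma solo_write {p u : Fin n} {j : Fin M} (todo : List (Loc n M L)) (a : Conf n M L)
    (h : a.phase p = .writing j u todo) : ∃ a', Solo enc p a a' ∧ a'.phase p = .writing j u [] ∧
      ∀ l, a'.mem l = if l ∈ todo then value enc u l else a.mem l := by
  induction todo generalizing a with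
  | nil => exact ⟨a, .refl, h, by simp⟩
  | cons l t ih =>
    obtain ⟨a', hs, hp, hm⟩ := ih _ (by simp : (⟨update a.phase p (.writing j u t),
      update a.mem l (value enc u l)⟩ : Conf n M L).phase p = .writing j u t)
    refine ⟨a', .head (.write j u l t h) hs, hp, fun l' => ?_⟩
    rw [hm]
    by_cases hl : l' = l
    · subst hl; simp
    · simp [hl]

/-- A process that runs alone completes its scan. -/
lemma solo_scan {p u : Fin n} (todo : List (Fin M × Fin L)) (view : Fin M × Fin L → Bool)
    (a : Conf n M L) (h : a.phase p = .scan u todo view) : ∃ a' view', Solo enc p a a' ∧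
      a'.phase p = .scan u [] view' ∧ a'.mem = a.mem ∧
      ∀ b, view' b = if b ∈ todo then a.bits b else view b := by
  induction todo generalizing a view with
  | nil => exact ⟨a, view, .refl, h, rfl, by simp⟩
  | cons c t ih =>
    obtain ⟨a', view', hs, hp, hm, hv⟩ := ih (update view c (a.mem (.cell c)))
      ⟨update a.phase p (.scan u t (update view c (a.mem (.cell c)))), a.mem⟩ (by simp)
    refine ⟨a', view', .head (.readBit u c t view h) hs, hp, hm, fun b => ?_⟩
    rw [hv]
    by_cases hb : b = c
    · subst hb; simp [Conf.bits]
    · simp [hb, Conf.bits]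

/-- A process that runs alone decides once it starts a scan: in each iteration, the number of cells
that do not hold its preference decreases. -/
lemma solo_loop (henc : Injective enc) {p : Fin n} (k : ℕ) : ∀ (u : Fin n) (a : Conf n M L)
    (view : Fin M × Fin L → Bool), a.phase p = .scan u (allBits M L) view →
    a.mem (.dirty p) = false → (bad enc a.bits u).card ≤ k →
    ∃ a' v, Solo enc p a a' ∧ a'.phase p = .done v := by
  induction k using Nat.strong_induction_on with
  | _ k ih =>
  intro u a view h hd hk
  obtain ⟨a₁, view', hs₁, hp₁, hm₁, hv⟩ := solo_scan (enc := enc) _ _ a h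
  obtain rfl : view' = a.bits := funext fun b => by simp [hv, allBits]
  obtain ⟨w, hw, hwk⟩ : ∃ w, w = (if a₁.mem (.present (majority enc a.bits u)) then
      majority enc a.bits u else u) ∧ (bad enc a.bits w).card ≤ k := by
    refine ⟨_, rfl, ?_⟩
    split_ifs with hpres
    · by_cases he : majority enc a.bits u = u
      · rwa [he]
      · have hmaj := (majority_eq_or (enc := enc) a.bits u).resolve_right he
        -- A majority value is bad in fewer than half of the cells, hence the old preference in more
        -- than half: adopting lowers the count.
        have := le_card_bad_add henc a.bits he
        unfold IsMajority at hmaj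
        omega
    · exact hk
  have step₁ := Move.adopt (enc := enc) (a := a₁) u _ hp₁
  rw [← hw] at step₁
  have step₂ := Move.finish (enc := enc) (p := p)
    (a := ⟨update a₁.phase p (.check w a.bits), a₁.mem⟩) w a.bits (by simp) (by simpa [hm₁] using hd)
  have hs₂ := (hs₁.tail step₁).tail step₂
  by_cases hb : (bad enc a.bits w).Nonempty
  · have hj := target_mem_bad hb
    simp only [afterScan, if_pos hb, update_idem] at hs₂
    set j := target enc a.bits w
    obtain ⟨a₃, hs₃, hp₃, hm₃⟩ := solo_write (enc := enc) (p := p) (u := w) (j := j) (writeList j)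
      ⟨update a₁.phase p (.writing j w (writeList j)), a₁.mem⟩ (by simp)
    have step₃ := Move.clear (enc := enc) (a := a₃) j w hp₃
    have hlt : (bad enc (Conf.bits ⟨update a₃.phase p (.scan w (allBits M L) fun _ => false),
        update a₃.mem (.dirty p) false⟩) w).card < k := by
      refine lt_of_lt_of_le (Finset.card_lt_card ?_) hwk
      -- No cell other than `j` is changed, and `j`, which was bad, now holds `w`.
      refine Finset.ssubset_iff_subset_ne.2 ⟨fun i hi => ?_, fun he => ?_⟩
      · obtain ⟨x, hx⟩ := mem_bad.1 hi
        refine mem_bad.2 ⟨x, ?_⟩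
        simp only [Conf.bits, ne_eq, reduceCtorEq, not_false_eq_true, update_of_ne, hm₃] at hx
        split_ifs at hx
        · exact absurd rfl hx
        · simpa [Conf.bits, hm₁] using hx
      · rw [← he] at hj
        obtain ⟨x, hx⟩ := mem_bad.1 hj
        simp [Conf.bits, hm₃, writeList, value] at hx
    obtain ⟨a₄, v, hs₄, hp₄⟩ := ih _ hlt w _ (fun _ => false) (by simp) (by simp) le_rfl
    exact ⟨a₄, v, ((hs₂.trans hs₃).tail step₃).trans hs₄, hp₄⟩
  · simp only [afterScan, if_neg hb] at hs₂
    exact ⟨_, w, hs₂, by simp⟩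

/-- A process that runs alone decides. -/
lemma exists_solo_done (henc : Injective enc) (p : Fin n) (a : Conf n M L) :
    ∃ a' v, Solo enc p a a' ∧ a'.phase p = .done v := by
  have hw : ∀ (a : Conf n M L) j u todo, a.phase p = .writing j u todo →
      ∃ a' v, Solo enc p a a' ∧ a'.phase p = .done v := by
    intro a j u todo h
    obtain ⟨a₁, hs₁, hp₁, -⟩ := solo_write (enc := enc) todo a h
    obtain ⟨a₂, v, hs₂, hp₂⟩ := solo_loop (enc := enc) henc (p := p) _ u
      ⟨update a₁.phase p (.scan u (allBits M L) fun _ => false), update a₁.mem (.dirty p) false⟩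
      _ (by simp; rfl) (by simp) le_rfl
    exact ⟨a₂, v, (hs₁.tail (.clear j u hp₁)).trans hs₂, hp₂⟩
  have hc : ∀ (a : Conf n M L) u view, a.phase p = .check u view →
      ∃ a' v, Solo enc p a a' ∧ a'.phase p = .done v := by
    intro a u view h
    cases hd : a.mem (.dirty p) with
    | true =>
      obtain ⟨a', v, hs, hp⟩ := hw ⟨update a.phase p (.writing 0 u []), a.mem⟩ 0 u [] (by simp)
      exact ⟨a', v, .head (.restart u view h hd) hs, hp⟩
    | false =>
      have step := Move.finish (enc := enc) u view h hd
      by_cases hb : (bad enc view u).Nonempty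
      · obtain ⟨a', v, hs, hp⟩ := hw ⟨update a.phase p (afterScan enc u view), a.mem⟩
          (target enc view u) u (writeList (target enc view u))
          (by simp only [update_self, afterScan, if_pos hb])
        exact ⟨a', v, .head step hs, hp⟩
      · exact ⟨_, u, .single step, by simp only [update_self, afterScan, if_neg hb]⟩
  cases h : a.phase p with
  | writing j u todo => exact hw a j u todo h
  | scan u todo view =>
    obtain ⟨a₁, view', hs₁, hp₁, -⟩ := solo_scan (enc := enc) todo view a h
    obtain ⟨a₂, v, hs₂, hp₂⟩ := hc ⟨update a₁.phase p (.check
      (if a₁.mem (.present (majority enc view' u)) then majority enc view' u else u) view'),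
      a₁.mem⟩ _ view' (update_self ..)
    exact ⟨a₂, v, (hs₁.tail (.adopt u view' hp₁)).trans hs₂, hp₂⟩
  | check u view => exact hc a u view h
  | done v => exact ⟨a, v, .refl, h⟩

end Protocol

/-! ### The algorithm -/

section Implementation

variable {n M L : ℕ}

/-- The cells, the dirty bits and the bits for the values that are present. -/
def locEquivSum : Loc n M L ≃ (Fin M × Fin L) ⊕ (Fin n ⊕ Fin n) where
  toFun
    | .cell b => .inl b
    | .dirty q => .inr (.inl q)
    | .present u => .inr (.inr u)
  invFun
    | .inl b => .cell b
    | .inr (.inl q) => .dirty q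
    | .inr (.inr u) => .present u
  left_inv l := by cases l <;> rfl
  right_inv s := by rcases s with b | q | u <;> rfl

/-- A numbering of the locations. -/
def locEquiv : Loc n M L ≃ Fin (M * L + (n + n)) :=
  locEquivSum.trans <| (Equiv.sumCongr finProdFinEquiv finSumFinEquiv).trans finSumFinEquiv

/-- The instruction that writes the bit `x`. -/
def setTo (set₁ set₀ : Instruction Bool) (x : Bool) :
    ({read, set₁, set₀} : Set (Instruction Bool)) :=
  if x then ⟨set₁, by simp⟩ else ⟨set₀, by simp⟩

variable [NeZero M] (enc : Fin n → Fin L → Bool) {set₁ set₀ : Instruction Bool}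

/-- The next instruction of process `p`. -/
noncomputable def nextAction (set₁ set₀ : Instruction Bool) (p : Fin n) : Phase n M L →
    Action ({read, set₁, set₀} : Set (Instruction Bool)) (M * L + (n + n)) n
  | .writing _ u (l :: _) => .poised (locEquiv l) (setTo set₁ set₀ (value enc u l))
  | .writing _ _ [] => .poised (locEquiv (.dirty p : Loc n M L)) (setTo set₁ set₀ false)
  | .scan _ (b :: _) _ => .poised (locEquiv (.cell b : Loc n M L)) ⟨read, by simp⟩
  | .scan u [] view =>
    .poised (locEquiv (.present (majority enc view u) : Loc n M L)) ⟨read, by simp⟩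
  | .check _ _ => .poised (locEquiv (.dirty p : Loc n M L)) ⟨read, by simp⟩
  | .done v => .decided v

/-- The state of a process after it receives the response `x`. -/
noncomputable def nextPhase (x : Bool) : Phase n M L → Phase n M L
  | .writing j u (_ :: t) => .writing j u t
  | .writing _ u [] => .scan u (allBits M L) fun _ => false
  | .scan u (b :: t) view => .scan u t (update view b x)
  | .scan u [] view => .check (if x then majority enc view u else u) view
  | .check u view => if x then .writing 0 u [] else afterScan enc u view
  | .done v => .done v

/-- The protocol as an algorithm. -/
noncomputable def algorithm (M : ℕ) [NeZero M] (set₁ set₀ : Instruction Bool) :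
    Algorithm ({read, set₁, set₀} : Set (Instruction Bool)) n (M * L + (n + n)) n where
  State := Fin n × Phase n M L
  init p u := (p, .writing 0 u [.present u])
  action s := nextAction enc set₁ set₀ s.1 s.2
  -- The default is harmless: `nextPhase` uses the response only after a read. The response of a
  -- test-and-set is likewise ignored.
  next s x := (s.1, nextPhase enc (x.getD false) s.2)

/-- A configuration of the protocol as a configuration of the algorithm. -/
noncomputable def toConfig (set₁ set₀ : Instruction Bool) (a : Conf n M L) :
    Config (algorithm enc M set₁ set₀) where
  state p := (p, a.phase p)
  mem i := a.mem (locEquiv.symm i)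

/-- The outcome of a step of process `p` that executes `op` on the location `l`. -/
noncomputable def perform (p : Fin n) (l : Loc n M L) (op : Instruction Bool)
    (a : Conf n M L) : Conf n M L :=
  ⟨update a.phase p (nextPhase enc ((op (a.mem l)).2.getD false) (a.phase p)),
    update a.mem l (op (a.mem l)).1⟩

variable {enc}

lemma toConfig_update (a : Conf n M L) (p : Fin n) (ph : Phase n M L) (l : Loc n M L) (x : Bool) :
    toConfig enc set₁ set₀ ⟨update a.phase p ph, update a.mem l x⟩ =
      { state := update (toConfig enc set₁ set₀ a).state p (p, ph)
        mem := update (toConfig enc set₁ set₀ a).mem (locEquiv l) x } := by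
  unfold toConfig
  congr 1
  · funext q
    change _ = update (β := fun _ => Fin n × Phase n M L) (fun p => (p, a.phase p)) p (p, ph) q
    by_cases hq : q = p
    · subst hq; simp
    · simp [hq]
  · funext i
    by_cases hi : i = locEquiv l
    · subst hi; simp
    · have : locEquiv.symm i ≠ l := by rintro rfl; simp at hi
      simp [hi, this]

lemma setTo_fst (h₁ : ∀ x, (set₁ x).1 = true) (h₀ : ∀ x, (set₀ x).1 = false) (x y : Bool) :
    ((setTo set₁ set₀ x).1 y).1 = x := by
  cases x <;> simp [setTo, h₁, h₀]

lemma step_iff {p : Fin n} {a : Conf n M L} {C : Config (algorithm enc M set₁ set₀)} :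
    (algorithm enc M set₁ set₀).Step p (toConfig enc set₁ set₀ a) C ↔
      ∃ l op, nextAction enc set₁ set₀ p (a.phase p) = .poised (locEquiv l) op ∧
        C = toConfig enc set₁ set₀ (perform enc p l op.1 a) := by
  unfold Algorithm.Step perform
  rw [← locEquiv.exists_congr_right]
  refine exists_congr fun l => exists_congr fun op => and_congr Iff.rfl ?_
  rw [toConfig_update]
  simp [toConfig, algorithm]

lemma move_iff (h₁ : ∀ x, (set₁ x).1 = true) (h₀ : ∀ x, (set₀ x).1 = false) {p : Fin n}
    {a a' : Conf n M L} : Move enc p a a' ↔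
      ∃ l op, nextAction enc set₁ set₀ p (a.phase p) = .poised (locEquiv l) op ∧
        a' = perform enc p l op.1 a := by
  constructor
  · intro h
    cases h with
    | write j u l t h =>
      exact ⟨l, _, by rw [h]; rfl, by simp [perform, setTo_fst h₁ h₀, h, nextPhase]⟩
    | clear j u h =>
      exact ⟨.dirty p, _, by rw [h]; rfl, by simp [perform, setTo_fst h₁ h₀, h, nextPhase]⟩
    | readBit u b t view h =>
      exact ⟨.cell b, _, by rw [h]; rfl, by simp [perform, SharedMemory.read, h, nextPhase]⟩
    | adopt u view h =>
      exact ⟨_, _, by rw [h]; rfl, by simp [perform, SharedMemory.read, h, nextPhase]; rfl⟩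
    | restart u view h hd =>
      exact ⟨.dirty p, _, by rw [h]; rfl, by simp [perform, SharedMemory.read, h, nextPhase, hd]⟩
    | finish u view h hd =>
      exact ⟨.dirty p, _, by rw [h]; rfl, by simp [perform, SharedMemory.read, h, nextPhase, hd]⟩
  · rintro ⟨l, op, hact, rfl⟩
    match h : a.phase p with
    | .writing j u (l' :: t) =>
      simp only [h, nextAction, Action.poised.injEq, EmbeddingLike.apply_eq_iff_eq] at hact
      obtain ⟨rfl, rfl⟩ := hact
      simpa [perform, setTo_fst h₁ h₀, h, nextPhase] using Move.write (enc := enc) j u l' t h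
    | .writing j u [] =>
      simp only [h, nextAction, Action.poised.injEq, EmbeddingLike.apply_eq_iff_eq] at hact
      obtain ⟨rfl, rfl⟩ := hact
      simpa [perform, setTo_fst h₁ h₀, h, nextPhase] using Move.clear (enc := enc) j u h
    | .scan u (b :: t) view =>
      simp only [h, nextAction, Action.poised.injEq, EmbeddingLike.apply_eq_iff_eq] at hact
      obtain ⟨rfl, rfl⟩ := hact
      simpa [perform, SharedMemory.read, h, nextPhase] using Move.readBit (enc := enc) u b t view h
    | .scan u [] view =>
      simp only [h, nextAction, Action.poised.injEq, EmbeddingLike.apply_eq_iff_eq] at hact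
      obtain ⟨rfl, rfl⟩ := hact
      simp only [perform, SharedMemory.read, h, nextPhase, Option.getD_some, update_eq_self]
      exact Move.adopt u view h
    | .check u view =>
      simp only [h, nextAction, Action.poised.injEq, EmbeddingLike.apply_eq_iff_eq] at hact
      obtain ⟨rfl, rfl⟩ := hact
      simp only [perform, SharedMemory.read, h, nextPhase, Option.getD_some, update_eq_self]
      cases hd : a.mem (.dirty p) with
      | true => simpa using Move.restart (enc := enc) u view h hd
      | false => simpa using Move.finish (enc := enc) u view h hd
    | .done v => simp [h, nextAction] at hact

/-- This transfers the protocol both ways: reachable configurations come from runs of `Move`, and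
solo runs of `Move` give solo executions of the algorithm. -/
lemma step_toConfig_iff (h₁ : ∀ x, (set₁ x).1 = true) (h₀ : ∀ x, (set₀ x).1 = false) {p : Fin n}
    {a : Conf n M L} {C : Config (algorithm enc M set₁ set₀)} :
    (algorithm enc M set₁ set₀).Step p (toConfig enc set₁ set₀ a) C ↔
      ∃ a', Move enc p a a' ∧ C = toConfig enc set₁ set₀ a' := by
  simp only [step_iff, move_iff h₁ h₀]
  constructor
  · rintro ⟨l, op, h, rfl⟩
    exact ⟨_, ⟨l, op, h, rfl⟩, rfl⟩
  · rintro ⟨_, ⟨l, op, h, rfl⟩, rfl⟩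
    exact ⟨l, op, h, rfl⟩

lemma decides_toConfig_iff {a : Conf n M L} {p v : Fin n} :
    (algorithm enc M set₁ set₀).Decides (toConfig enc set₁ set₀ a) p v ↔ a.phase p = .done v := by
  change nextAction enc set₁ set₀ p (a.phase p) = .decided v ↔ _
  match a.phase p with
  | .writing j u (l :: t) => simp [nextAction]
  | .writing j u [] => simp [nextAction]
  | .scan u (b :: t) view => simp [nextAction]
  | .scan u [] view => simp [nextAction]
  | .check u view => simp [nextAction]
  | .done v => simp [nextAction]

theorem algorithm_solvesConsensus (h₁ : ∀ x, (set₁ x).1 = true) (h₀ : ∀ x, (set₀ x).1 = false)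
    (henc : Injective enc) (hM : 6 * n < M) :
    (algorithm enc M set₁ set₀).SolvesConsensus false := by
  intro input C hC
  obtain ⟨a, ha, rfl⟩ : ∃ a, Run enc (start input) a ∧ C = toConfig enc set₁ set₀ a := by
    induction hC with
    | refl => exact ⟨_, .refl, rfl⟩
    | tail _ h ih =>
      obtain ⟨a, ha, rfl⟩ := ih
      obtain ⟨p, h⟩ := h
      obtain ⟨a', h', rfl⟩ := (step_toConfig_iff h₁ h₀).1 h
      exact ⟨a', ha.tail ⟨p, h'⟩, rfl⟩
  have inv := ha.inv henc hM
  refine ⟨fun p q v w hv hw => ?_, fun p v hv => ?_, fun p => ?_⟩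
  · exact inv.agreement henc hM (decides_toConfig_iff.1 hv) (decides_toConfig_iff.1 hw)
  · have := inv.pref_input p
    rwa [decides_toConfig_iff.1 hv] at this
  · obtain ⟨a', v, hs, hv⟩ := exists_solo_done henc p a
    refine ⟨toConfig enc set₁ set₀ a', v, ?_, decides_toConfig_iff.2 hv⟩
    exact Relation.ReflTransGen.lift _ (fun b b' h => (step_toConfig_iff h₁ h₀).2 ⟨b', h, rfl⟩) _ _ hs

end Implementation

/-! ### Counting the locations -/

/-- From `log 2 ≥ 2/3` follow `clog 2 n ≤ 1 + log n / log 2 ≤ 3 log n` and `2n ≤ 3 n log n`, so the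
constant is `7 * 3 + 3 = 24`. -/
lemma locations_le {n : ℕ} (hn : 2 ≤ n) :
    ((7 * n * Nat.clog 2 n + (n + n) : ℕ) : ℝ) ≤ 24 * (n * Real.log n) := by
  have hlog2 : (2 / 3 : ℝ) ≤ Real.log 2 := by linarith [Real.log_two_gt_d9]
  have hlog : Real.log 2 ≤ Real.log n :=
    Real.log_le_log (by norm_num) (by exact_mod_cast hn)
  have hclog : (Nat.clog 2 n : ℝ) ≤ 3 * Real.log n := by
    have h₁ : 2 ^ (Nat.clog 2 n - 1) < n := Nat.pow_pred_clog_lt_self (by norm_num) (by omega)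
    have h₂ : ((Nat.clog 2 n - 1 : ℕ) : ℝ) * Real.log 2 ≤ Real.log n := by
      rw [← Real.log_pow]
      exact Real.log_le_log (by positivity) (by exact_mod_cast h₁.le)
    have h₃ : 1 ≤ Nat.clog 2 n := Nat.clog_pos (by norm_num) hn
    rw [Nat.cast_sub h₃] at h₂
    push_cast at h₂
    have h₄ : (1 : ℝ) ≤ Nat.clog 2 n := by exact_mod_cast h₃
    nlinarith
  have hn0 : (0 : ℝ) ≤ n := by positivity
  push_cast
  nlinarith [mul_le_mul_of_nonneg_left hclog hn0, mul_le_mul_of_nonneg_left hlog hn0,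
    mul_le_mul_of_nonneg_left hlog2 hn0]

lemma exists_injective_enc (n : ℕ) : ∃ enc : Fin n → Fin (Nat.clog 2 n) → Bool, Injective enc := by
  have : Nonempty (Fin n ↪ (Fin (Nat.clog 2 n) → Bool)) :=
    Embedding.nonempty_of_card_le (by simpa using Nat.le_pow_clog (by norm_num) n)
  exact ⟨this.some, this.some.injective⟩

end CellConsensus

theorem mainTheorem11 :
    ∀ set₁ ∈ ({SharedMemory.write true, SharedMemory.testAndSet} :
        Set (SharedMemory.Instruction Bool)),
    ∀ set₀ ∈ ({SharedMemory.write false, SharedMemory.reset} :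
        Set (SharedMemory.Instruction Bool)),
    ∃ c : ℝ, ∀ n : ℕ, 2 ≤ n → ∃ m : ℕ, (m : ℝ) ≤ c * (n * Real.log n) ∧
      SharedMemory.NConsensusSolvable {SharedMemory.read, set₁, set₀} false n m := by
  intro set₁ hset₁ set₀ hset₀
  have h₁ : ∀ x, (set₁ x).1 = true := by rcases hset₁ with rfl | rfl <;> exact fun _ => rfl
  have h₀ : ∀ x, (set₀ x).1 = false := by rcases hset₀ with rfl | rfl <;> exact fun _ => rfl
  -- The number of cells is taken to be `7n`, which exceeds `6n` as agreement requires.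
  refine ⟨24, fun n hn => ⟨_, CellConsensus.locations_le hn, ?_⟩⟩
  have : NeZero (7 * n) := ⟨by omega⟩
  obtain ⟨enc, henc⟩ := CellConsensus.exists_injective_enc n
  exact ⟨CellConsensus.algorithm enc (7 * n) set₁ set₀,
    CellConsensus.algorithm_solvesConsensus h₁ h₀ henc (by omega)⟩
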